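/- For all integers $r,d\ge 2$ there is a finite $r$-uniform $r$-partite hypergraph $H_{r,d}$ such that $$\mathrm{ch}_{sep}(H_{r,d})=\mathrm{ch}_{ad}(H_{r,d})=\chi_{\nleftrightarrow}(H_{r,d})=\mathrm{ch}(H_{r,d})=\chi_{DP}(H_{r,d})=d.$$ Here a hypergraph is $r$-uniform if every edge has exactly $r$ vertices, and $r$-partite if its vertex set can be partitioned into $r$ sets such that every edge contains at most one vertex of each. A coloring is proper if no edge is monochromatic. For a hypergraph $H$: - $\mathrm{ch}(H)$ is the least $k$ such that $H$ has a proper coloring $\varphi$ with $\varphi(v)\in L(v)$ for all vertices $v$, for every assignment $L$ of lists of at least $k$ colors to the vertices. - $\mathrm{ch}_{sep}(H)$ is the least $k$ such that this holds for all such $L$ with $|L(u)\cap L(v)|\le 1$ whenever $u\neq v$ lie in a common edge. - $\mathrm{ch}_{ad}(H)$ is the least $k$ such that for every assignment $L$ of lists of at least $k$ colors to the vertices and every coloring $f$ of the edges there is a (not necessarily proper) coloring $\varphi$ with $\varphi(v)\in L(v)$ for all $v$ such that no edge $e$ has all its vertices colored $f(e)$. - $\chi_{\nleftrightarrow}(H)$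 (the single conflict chromatic number) is the least $k\ge 1$ such that for every family of maps $c_v:\{e\in E(H): v\in e\}\to\{1,\dots,k\}$, $v\in V(H)$, there is $\varphi:V(H)\to\{1,\dots,k\}$ such that no edge $e$ satisfies $\varphi(v)=c_v(e)$ for all $v\in e$. - $\chi_{DP}(H)$ (the DP-chromatic number) is the least $k$ such that every cover of $H$ with $|X_v|\ge k$ for all $v$ has an independent transversal. A cover consists of pairwise disjoint finite sets $X_v$, $v\in V(H)$, and, for every edge $e$ of $H$, a (possibly empty) set $M_e$ of pairwise disjoint subsets of $\bigcup_{v\in e}X_v$, each meeting every $X_v$, $v\in e$, in exactly one point. An independent transversal is a set $T\subseteq\bigcup_v X_v$ that meets every $X_v$ in exactly one point and contains no member of any $M_e$. -/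

import Mathlib

namespace Hypergraph

universe u v

variable {V : Type u}

/-- Every edge has exactly `r` vertices. -/
def IsUniform (H : Hypergraph V) (r : ℕ) : Prop :=
  ∀ e ∈ H.edgeSet, e.ncard = r

/-- The vertex set can be partitioned into `k` sets so that each edge contains at most one vertex
from each of them. -/
def IsPartite (H : Hypergraph V) (k : ℕ) : Prop :=
  ∃ P : Fin k → Set V, Pairwise (fun i j => Disjoint (P i) (P j)) ∧ (⋃ i, P i) = H.vertexSet ∧
    ∀ e ∈ H.edgeSet, ∀ i, (e ∩ P i).Subsingleton

/-! ### List colorings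

Colors are integers.  The invariants below are the least `k` with the stated property; for a finite
hypergraph without edges of size at most one such a `k` exists. -/

/-- `φ` is a coloring of the vertices from the lists `L` (not necessarily proper). -/
def IsFromLists (H : Hypergraph V) (L : V → Finset ℤ) (φ : V → ℤ) : Prop :=
  ∀ v ∈ H.vertexSet, φ v ∈ L v

/-- No edge is monochromatic under `φ`. -/
def IsProperColoring (H : Hypergraph V) (φ : V → ℤ) : Prop :=
  ∀ e ∈ H.edgeSet, ¬ ∃ a, ∀ v ∈ e, φ v = a

/-- All lists have size at least `k`. -/
def IsListAssignment (H : Hypergraph V) (k : ℕ) (L : V → Finset ℤ) : Prop :=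
  ∀ v ∈ H.vertexSet, k ≤ (L v).card

/-- The lists of any two distinct vertices of a common edge share at most one color. -/
def IsSeparated (H : Hypergraph V) (L : V → Finset ℤ) : Prop :=
  ∀ e ∈ H.edgeSet, ∀ u ∈ e, ∀ v ∈ e, u ≠ v → (L u ∩ L v).card ≤ 1

/-- `H` is `k`-choosable. -/
def IsChoosable (H : Hypergraph V) (k : ℕ) : Prop :=
  ∀ L : V → Finset ℤ, H.IsListAssignment k L →
    ∃ φ, H.IsFromLists L φ ∧ H.IsProperColoring φ

/-- The choice number `ch(H)`. -/
noncomputable def ch (H : Hypergraph V) : ℕ := sInf {k | H.IsChoosable k}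

/-- `H` is colorable from all separated lists of size at least `k`. -/
def IsSepChoosable (H : Hypergraph V) (k : ℕ) : Prop :=
  ∀ L : V → Finset ℤ, H.IsListAssignment k L → H.IsSeparated L →
    ∃ φ, H.IsFromLists L φ ∧ H.IsProperColoring φ

/-- The separation choosability of `H`. -/
noncomputable def chSep (H : Hypergraph V) : ℕ := sInf {k | H.IsSepChoosable k}

/-- The coloring `φ` is adapted to the edge coloring `f`: no edge `e` has all its vertices colored
`f e`. -/
def IsAdapted (H : Hypergraph V) (f : Set V → ℤ) (φ : V → ℤ) : Prop :=
  ∀ e ∈ H.edgeSet, ¬ ∀ v ∈ e, φ v = f e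

/-- For every edge coloring and all lists of size at least `k` there is an adapted list coloring. -/
def IsAdChoosable (H : Hypergraph V) (k : ℕ) : Prop :=
  ∀ (L : V → Finset ℤ) (f : Set V → ℤ), H.IsListAssignment k L →
    ∃ φ, H.IsFromLists L φ ∧ H.IsAdapted f φ

/-- The adaptable choosability of `H`. -/
noncomputable def chAd (H : Hypergraph V) : ℕ := sInf {k | H.IsAdChoosable k}

/-! ### Single conflict coloring -/

/-- `H` is conflict-colorable for every local `k`-partition `c`. The color `c v e` is only relevant
if `v` is a vertex of the edge `e`. -/
def IsConflictColorable (H : Hypergraph V) (k : ℕ) : Prop :=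
  ∀ c : V → Set V → Fin k, ∃ φ : V → Fin k, ∀ e ∈ H.edgeSet, ¬ ∀ v ∈ e, φ v = c v e

/-- The single conflict chromatic number of `H`: the least positive `k` such that `H` is
conflict-colorable for every local `k`-partition. (For `k = 0` there would be no local
`k`-partition at all as soon as `H` has a nonempty edge.) -/
noncomputable def singleConflictChromaticNumber (H : Hypergraph V) : ℕ :=
  sInf {k | 0 < k ∧ H.IsConflictColorable k}

/-! ### DP-coloring -/

/-- A cover of `H`, with vertices in `W`: every vertex `v` is replaced by a set `fiber v`, and every
edge `e` by a (possibly empty) matching consisting of edges that meet `fiber v` in exactly one point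
for each `v ∈ e` and contain no other points. The value `matching e` is only relevant if `e` is an
edge of `H`. -/
structure Cover (H : Hypergraph V) (W : Type v) where
  fiber : V → Finset W
  fiber_disjoint : ∀ u ∈ H.vertexSet, ∀ v ∈ H.vertexSet, u ≠ v → Disjoint (fiber u) (fiber v)
  matching : Set V → Set (Set W)
  matching_subset : ∀ e ∈ H.edgeSet, ∀ m ∈ matching e, ∀ x ∈ m, ∃ v ∈ e, x ∈ fiber v
  matching_inter : ∀ e ∈ H.edgeSet, ∀ m ∈ matching e, ∀ v ∈ e, ∃! x, x ∈ m ∧ x ∈ fiber v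
  matching_disjoint : ∀ e ∈ H.edgeSet, ∀ m ∈ matching e, ∀ m' ∈ matching e, m ≠ m' → Disjoint m m'

/-- The hypergraph formed by all fibers and all matchings of a cover. -/
def Cover.toHypergraph {H : Hypergraph V} {W : Type v} (C : H.Cover W) : Hypergraph W where
  vertexSet := {x | ∃ v ∈ H.vertexSet, x ∈ C.fiber v}
  edgeSet := {m | ∃ e ∈ H.edgeSet, m ∈ C.matching e}
  subset_vertexSet_of_mem_edgeSet' := by
    rintro m ⟨e, he, hm⟩ x hx
    obtain ⟨v, hv, hxv⟩ := C.matching_subset e he m hm x hx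
    exact ⟨v, H.subset_vertexSet_of_mem_edgeSet' he hv, hxv⟩

/-- `T` is an independent set of the cover that has exactly one point in each fiber. -/
def Cover.IsTransversal {H : Hypergraph V} {W : Type v} (C : H.Cover W) (T : Set W) : Prop :=
  T ⊆ C.toHypergraph.vertexSet ∧ (∀ v ∈ H.vertexSet, ∃! x, x ∈ T ∧ x ∈ C.fiber v) ∧
    ∀ m ∈ C.toHypergraph.edgeSet, ¬ m ⊆ T

/-- `H` is `k`-DP-colorable: every cover whose fibers have size at least `k` has an independent
transversal. -/
def IsDPColorable (H : Hypergraph V) (k : ℕ) : Prop :=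
  ∀ (W : Type u) (C : H.Cover W), (∀ v ∈ H.vertexSet, k ≤ (C.fiber v).card) →
    ∃ T, C.IsTransversal T

/-- The DP-chromatic number of `H`. -/
noncomputable def dpChromaticNumber (H : Hypergraph V) : ℕ := sInf {k | H.IsDPColorable k}

end Hypergraph

namespace Hypergraph

/-! ### Comparison of the invariants, and DP-coloring from a degree bound -/

section Comparison

variable {V : Type u} {H : Hypergraph V}

/-! When edges have at least two vertices, separation choosability is the smallest of the five
invariants and the DP-chromatic number the largest. So with `k = d - 1` it suffices to find a
hypergraph that is `(k + 1)`-DP-colorable but not separately `k`-choosable. The lists that defeat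
`k` are built by induction on the uniformity (`SepObstruction.extend`): take `k` copies with
disjoint palettes and add a vertex for each choice of one edge and one color per copy. Any coloring
leaves a monochromatic edge in each copy; the new vertex recording these edges and their colors must
repeat one of the colors. A new vertex lies in at most `k` edges and each edge contains just one, so
`k + 1` points per fiber allow coloring the copies arbitrarily and the new vertices last
(`isDPColorable_of_degree_le`). -/

theorem IsDPColorable.isChoosable {k : ℕ}
    (hk : H.IsDPColorable k) : H.IsChoosable k := by
  classical
  intro L hL
  let C : H.Cover (V × ℤ) :=
    { fiber := fun v => (L v).image (fun c => (v, c))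
      fiber_disjoint := by
        intro u _ v _ huv
        rw [Finset.disjoint_left]
        rintro x hx hx'
        simp only [Finset.mem_image] at hx hx'
        obtain ⟨a, _, rfl⟩ := hx
        obtain ⟨b, _, hb⟩ := hx'
        exact huv (Prod.ext_iff.1 hb).1.symm
      matching := fun e => {m | ∃ a, (∀ v ∈ e, a ∈ L v) ∧ m = {x | x.1 ∈ e ∧ x.2 = a}}
      matching_subset := by
        rintro e he m ⟨a, ha, rfl⟩ ⟨v, c⟩ ⟨hv, rfl⟩
        exact ⟨v, hv, Finset.mem_image.2 ⟨c, ha v hv, rfl⟩⟩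
      matching_inter := by
        rintro e he m ⟨a, ha, rfl⟩ v hv
        refine ⟨(v, a), ⟨⟨hv, rfl⟩, Finset.mem_image.2 ⟨a, ha v hv, rfl⟩⟩, ?_⟩
        rintro ⟨w, c⟩ ⟨⟨_, hc⟩, h2⟩
        obtain ⟨b, _, hb⟩ := Finset.mem_image.1 h2
        exact Prod.ext (Prod.ext_iff.1 hb).1.symm hc
      matching_disjoint := by
        rintro e he m ⟨a, ha, rfl⟩ m' ⟨a', ha', rfl⟩ hne
        rw [Set.disjoint_left]
        rintro x ⟨_, h1⟩ ⟨_, h2⟩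
        exact hne (by rw [← h1, ← h2]) }
  obtain ⟨T, hT, hT1, hT2⟩ := hk (V × ℤ) C (fun v hv => by
    have := Finset.card_image_of_injective (L v) (Prod.mk_right_injective v)
    exact (hL v hv).trans this.ge)
  have hex : ∀ v, ∃ c, v ∈ H.vertexSet → (v, c) ∈ T ∧ c ∈ L v := by
    intro v
    by_cases hv : v ∈ H.vertexSet
    · obtain ⟨x, ⟨hx, hx'⟩, _⟩ := hT1 v hv
      obtain ⟨c, hc, rfl⟩ := Finset.mem_image.1 hx'
      exact ⟨c, fun _ => ⟨hx, hc⟩⟩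
    · exact ⟨0, fun h => absurd h hv⟩
  choose φ hφ using hex
  refine ⟨φ, fun v hv => (hφ v hv).2, ?_⟩
  rintro e he ⟨a, ha⟩
  have hev : ∀ v ∈ e, v ∈ H.vertexSet := fun v hv => H.subset_vertexSet_of_mem_edgeSet' he hv
  refine hT2 {x | x.1 ∈ e ∧ x.2 = a}
    ⟨e, he, a, fun v hv => ha v hv ▸ (hφ v (hev v hv)).2, rfl⟩ ?_
  rintro ⟨v, c⟩ ⟨hv, hc⟩
  have := (hφ v (hev v hv)).1
  rw [ha v hv] at this
  simpa only [← hc] using this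

/-- A conflict is a matching with a single member, so disjointness is vacuous. -/
theorem IsDPColorable.isConflictColorable {k : ℕ} (hk0 : 0 < k)
    (hk : H.IsDPColorable k) : H.IsConflictColorable k := by
  classical
  intro c
  let C : H.Cover (V × Fin k) :=
    { fiber := fun v => Finset.univ.image (fun a => (v, a))
      fiber_disjoint := by
        intro u _ v _ huv
        rw [Finset.disjoint_left]
        rintro x hx hx'
        simp only [Finset.mem_image] at hx hx'
        obtain ⟨a, _, rfl⟩ := hx
        obtain ⟨b, _, hb⟩ := hx'
        exact huv (Prod.ext_iff.1 hb).1.symm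
      matching := fun e => {{x | x.1 ∈ e ∧ x.2 = c x.1 e}}
      matching_subset := by
        rintro e he m rfl ⟨v, a⟩ ⟨hv, _⟩
        exact ⟨v, hv, Finset.mem_image.2 ⟨a, Finset.mem_univ _, rfl⟩⟩
      matching_inter := by
        rintro e he m rfl v hv
        refine ⟨(v, c v e), ⟨⟨hv, rfl⟩, Finset.mem_image.2 ⟨_, Finset.mem_univ _, rfl⟩⟩, ?_⟩
        rintro ⟨w, a⟩ ⟨⟨_, hc⟩, h2⟩
        obtain ⟨b, _, hb⟩ := Finset.mem_image.1 h2
        have hw : v = w := (Prod.ext_iff.1 hb).1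
        subst hw
        exact Prod.ext rfl hc
      matching_disjoint := by
        rintro e he m rfl m' rfl hne
        exact absurd rfl hne }
  obtain ⟨T, hT, hT1, hT2⟩ := hk (V × Fin k) C (fun v hv => by
    have := Finset.card_image_of_injective (Finset.univ : Finset (Fin k))
      (Prod.mk_right_injective v)
    rw [Finset.card_univ, Fintype.card_fin] at this
    exact this.ge)
  have hex : ∀ v, ∃ a, v ∈ H.vertexSet → (v, a) ∈ T := by
    intro v
    by_cases hv : v ∈ H.vertexSet
    · obtain ⟨x, ⟨hx, hx'⟩, _⟩ := hT1 v hv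
      obtain ⟨a, _, rfl⟩ := Finset.mem_image.1 hx'
      exact ⟨a, fun _ => hx⟩
    · exact ⟨⟨0, hk0⟩, fun h => absurd h hv⟩
  choose φ hφ using hex
  refine ⟨φ, fun e he hall => ?_⟩
  refine hT2 {x | x.1 ∈ e ∧ x.2 = c x.1 e} ⟨e, he, rfl⟩ ?_
  rintro ⟨v, a⟩ ⟨hv, ha⟩
  have := hφ v (H.subset_vertexSet_of_mem_edgeSet' he hv)
  rw [hall v hv] at this
  simpa only [← ha] using this

/-- Number `k` colors of each list by an injection `g v` and pull `f e` back along it. If `f e` is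
not a value of `g v`, the junk value of `invFun` only adds a harmless conflict. -/
theorem IsConflictColorable.isAdChoosable {k : ℕ} (hk0 : 0 < k)
    (hk : H.IsConflictColorable k) : H.IsAdChoosable k := by
  classical
  intro L f hL
  have hex : ∀ v, ∃ g : Fin k → ℤ, v ∈ H.vertexSet →
      Function.Injective g ∧ ∀ i, g i ∈ L v := by
    intro v
    by_cases hv : v ∈ H.vertexSet
    · obtain ⟨s, hs, hcard⟩ := Finset.exists_subset_card_eq (hL v hv)
      exact ⟨fun i => (s.equivFinOfCardEq hcard).symm i, fun _ =>
        ⟨Subtype.val_injective.comp (Equiv.injective _), fun i => hs (Subtype.property _)⟩⟩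
    · exact ⟨fun _ => 0, fun h => absurd h hv⟩
  choose g hg using hex
  have : Nonempty (Fin k) := ⟨⟨0, hk0⟩⟩
  obtain ⟨φ, hφ⟩ := hk (fun v e => Function.invFun (g v) (f e))
  refine ⟨fun v => g v (φ v), fun v hv => (hg v hv).2 _, fun e he hall => hφ e he fun v hv => ?_⟩
  rw [← hall v hv]
  exact (Function.leftInverse_invFun
    (hg v (H.subset_vertexSet_of_mem_edgeSet' he hv)).1 _).symm

/-- Separation leaves at most one color common to all lists on an edge with two vertices; give the
edge that color. -/
theorem IsAdChoosable.isSepChoosable {k : ℕ} (h : ∀ e ∈ H.edgeSet, e.Nontrivial)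
    (hk : H.IsAdChoosable k) : H.IsSepChoosable k := by
  classical
  intro L hL hsep
  obtain ⟨φ, hφ, had⟩ := hk L
    (fun e => if he : ∃ a, ∀ v ∈ e, a ∈ L v then he.choose else 0) hL
  refine ⟨φ, hφ, ?_⟩
  rintro e he ⟨a, ha⟩
  have hmem : ∀ v ∈ e, a ∈ L v := fun v hv =>
    ha v hv ▸ hφ v (H.subset_vertexSet_of_mem_edgeSet' he hv)
  have hex : ∃ a, ∀ v ∈ e, a ∈ L v := ⟨a, hmem⟩
  refine had e he fun v hv => ?_
  simp only [dif_pos hex]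
  rw [ha v hv]
  obtain ⟨x, hx, y, hy, hxy⟩ := h e he
  exact Finset.card_le_one.1 (hsep e he x hx y hy hxy) a
    (Finset.mem_inter.2 ⟨hmem x hx, hmem y hy⟩) _
    (Finset.mem_inter.2 ⟨hex.choose_spec x hx, hex.choose_spec y hy⟩)

theorem IsChoosable.isSepChoosable {k : ℕ} (hk : H.IsChoosable k) : H.IsSepChoosable k :=
  fun L hL _ => hk L hL

theorem IsSepChoosable.mono {j k : ℕ} (hjk : j ≤ k) (hj : H.IsSepChoosable j) :
    H.IsSepChoosable k :=
  fun L hL => hj L fun v hv => hjk.trans (hL v hv)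

/-- If every edge meets `B` in exactly one vertex and every vertex of `B` lies in at most `k` edges,
then a cover with fibers of size at least `k + 1` has an independent transversal, found by choosing
arbitrary points over the complement of `B` first. -/
theorem isDPColorable_of_degree_le {k : ℕ} (B : Set V)
    (hnt : ∀ e ∈ H.edgeSet, e.Nontrivial)
    (hB : ∀ e ∈ H.edgeSet, ∃ b ∈ B, e ∩ B = {b})
    (hfin : ∀ b ∈ B, {e | e ∈ H.edgeSet ∧ b ∈ e}.Finite)
    (hdeg : ∀ b ∈ B, {e | e ∈ H.edgeSet ∧ b ∈ e}.ncard ≤ k) : H.IsDPColorable (k + 1) := by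
  classical
  intro W C hC
  have hsub : ∀ e ∈ H.edgeSet, ∀ v ∈ e, v ∈ H.vertexSet := fun e he v hv =>
    H.subset_vertexSet_of_mem_edgeSet' he hv
  have hne : ∀ v ∈ H.vertexSet, ∃ x, x ∈ C.fiber v := fun v hv =>
    Finset.card_pos.1 (lt_of_lt_of_le (Nat.succ_pos k) (hC v hv))
  rcases isEmpty_or_nonempty W with hW | hW
  -- `choose!` below needs a default point of `W`.
  · have hV : ∀ v, v ∉ H.vertexSet := fun v hv => hW.elim (hne v hv).choose
    refine ⟨∅, Set.empty_subset _, fun v hv => absurd hv (hV v), ?_⟩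
    rintro m ⟨e, he, _⟩ _
    obtain ⟨v, hv⟩ := (hnt e he).nonempty
    exact hV v (hsub e he v hv)
  choose! g hg using hne
  have hchoice : ∀ b, b ∈ H.vertexSet ∧ b ∈ B → ∃ x ∈ C.fiber b, ∀ e ∈ H.edgeSet, b ∈ e →
      ∀ m ∈ C.matching e, x ∈ m → ¬ ∀ u ∈ e, u ≠ b → g u ∈ m := by
    rintro b ⟨hbV, hb⟩
    -- Pigeonhole: if every point of the fiber is blocked, two points are blocked by the same edge.
    -- Both matching members contain `g u` for another vertex `u` of that edge, so they coincide and
    -- would meet the fiber of `b` twice.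
    by_contra! hcon
    choose! E hE hbE M hM hxM hgM using hcon
    obtain ⟨x, hx, y, hy, hxy, hExy⟩ := Finset.exists_ne_map_eq_of_card_lt_of_maps_to
      (s := C.fiber b) (t := (hfin b hb).toFinset) (f := E)
      (by
        rw [← Set.ncard_eq_toFinset_card _ (hfin b hb)]
        exact lt_of_le_of_lt (hdeg b hb) (hC b hbV))
      (by
        intro x hx
        exact (hfin b hb).mem_toFinset.2 ⟨hE x hx, hbE x hx⟩)
    obtain ⟨u, hu, hub⟩ := (hnt _ (hE x hx)).exists_ne b
    have hMM : M x = M y := by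
      by_contra hne
      refine Set.disjoint_left.1 (C.matching_disjoint (E x) (hE x hx) _ (hM x hx) _ ?_ hne)
        (hgM x hx u hu hub) (hgM y hy u (hExy ▸ hu) hub)
      rw [hExy]
      exact hM y hy
    exact hxy ((C.matching_inter (E x) (hE x hx) _ (hM x hx) b (hbE x hx)).unique
      ⟨hxM x hx, hx⟩ ⟨hMM ▸ hxM y hy, hy⟩)
  choose! p hp hpe using hchoice
  let φ : V → W := fun v => if v ∈ B then p v else g v
  have hφ : ∀ v ∈ H.vertexSet, φ v ∈ C.fiber v := by
    intro v hv
    by_cases hvB : v ∈ B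
    · simpa only [φ, if_pos hvB] using hp v ⟨hv, hvB⟩
    · simpa only [φ, if_neg hvB] using hg v hv
  have huniq : ∀ v ∈ H.vertexSet, ∀ x ∈ C.fiber v, x ∈ φ '' H.vertexSet → x = φ v := by
    rintro v hv x hx ⟨w, hw, rfl⟩
    by_contra hne
    have hwv : w ≠ v := by
      rintro rfl
      exact hne rfl
    exact Finset.disjoint_left.1 (C.fiber_disjoint w hw v hv hwv) (hφ w hw) hx
  refine ⟨φ '' H.vertexSet, ?_, ?_, ?_⟩
  · rintro _ ⟨v, hv, rfl⟩
    exact ⟨v, hv, hφ v hv⟩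
  · intro v hv
    exact ⟨φ v, ⟨⟨v, hv, rfl⟩, hφ v hv⟩, fun x hx => huniq v hv x hx.2 hx.1⟩
  · rintro m ⟨e, he, hm⟩ hmT
    have hmem : ∀ v ∈ e, φ v ∈ m := by
      intro v hv
      obtain ⟨x, ⟨hxm, hxv⟩, _⟩ := C.matching_inter e he m hm v hv
      exact huniq v (hsub e he v hv) x hxv (hmT hxm) ▸ hxm
    obtain ⟨b, hb, heB⟩ := hB e he
    have hbe : b ∈ e := (heB.ge rfl).1
    refine hpe b ⟨hsub e he b hbe, hb⟩ e he hbe m hm ?_ fun u hu hub => ?_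
    · simpa only [φ, if_pos hb] using hmem b hbe
    · have huB : u ∉ B := fun h => hub (heB.le ⟨hu, h⟩)
      simpa only [φ, if_neg huB] using hmem u hu

end Comparison

/-! ### Recursive construction of separated lists without a proper coloring -/

/-- An `r`-uniform `r`-partite family of sets on a finite set of vertices, with separated lists of
size `k` such that every coloring from the lists has a monochromatic edge. -/
structure SepObstruction (r k : ℕ) where
  Vertex : Type
  Color : Type
  [finiteVertex : Finite Vertex]
  [finiteColor : Finite Color]
  edges : Set (Set Vertex)
  list : Vertex → Finset Color
  part : Vertex → Fin r
  ncard_eq : ∀ e ∈ edges, e.ncard = r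
  part_injOn : ∀ e ∈ edges, Set.InjOn part e
  card_list : ∀ v, (list v).card = k
  separated : ∀ e ∈ edges, ∀ u ∈ e, ∀ v ∈ e, u ≠ v →
    ∀ a ∈ list u, a ∈ list v → ∀ b ∈ list u, b ∈ list v → a = b
  exists_monochromatic : ∀ φ : Vertex → Color, (∀ v, φ v ∈ list v) →
    ∃ e ∈ edges, ∃ a, ∀ v ∈ e, φ v = a

namespace SepObstruction

attribute [instance] finiteVertex finiteColor

variable {r k : ℕ}

/-- A single vertex. -/
def single (k : ℕ) : SepObstruction 1 k where
  Vertex := Unit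
  Color := Fin k
  edges := {Set.univ}
  list _ := Finset.univ
  part _ := 0
  ncard_eq := by
    rintro e rfl
    simp
  part_injOn _ _ _ _ _ _ _ := rfl
  card_list _ := by simp
  separated _ _ _ _ _ _ huv := absurd rfl huv
  -- A one-vertex edge is always monochromatic.
  exists_monochromatic φ _ := ⟨Set.univ, rfl, φ (), fun _ _ => rfl⟩

variable (S : SepObstruction r k)

/-- Vertices of the extension: `k` copies of the old vertices, and a new vertex for each choice of
a set of vertices and a color in every copy. -/
abbrev ExtVertex : Type := (Fin k × S.Vertex) ⊕ (Fin k → Set S.Vertex × S.Color)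

/-- The edge of the extension consisting of the new vertex `b` and the set it selects in the `i`-th
copy. -/
def extEdge (b : Fin k → Set S.Vertex × S.Color) (i : Fin k) : Set S.ExtVertex :=
  insert (Sum.inr b) ((fun v => Sum.inl (i, v)) '' (b i).1)

open Classical in
/-- Lists of the extension: each copy has its own palette, and a new vertex gets the colors it
selects. -/
noncomputable def extList : S.ExtVertex → Finset (Fin k × S.Color) :=
  Sum.elim (fun x => (S.list x.2).image (Prod.mk x.1))
    (fun b => Finset.univ.image fun i => (i, (b i).2))

theorem mem_extList_inl {i : Fin k} {v : S.Vertex} {a : Fin k × S.Color} :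
    a ∈ S.extList (Sum.inl (i, v)) ↔ a.1 = i ∧ a.2 ∈ S.list v := by
  obtain ⟨j, c⟩ := a
  simp only [extList, Sum.elim_inl, Finset.mem_image, Prod.mk.injEq]
  constructor
  · rintro ⟨a, ha, rfl, rfl⟩
    exact ⟨rfl, ha⟩
  · rintro ⟨rfl, h⟩
    exact ⟨c, h, rfl, rfl⟩

theorem mem_extList_inr {b : Fin k → Set S.Vertex × S.Color} {a : Fin k × S.Color} :
    a ∈ S.extList (Sum.inr b) ↔ a.2 = (b a.1).2 := by
  obtain ⟨j, c⟩ := a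
  simp only [extList, Sum.elim_inr, Finset.mem_image, Finset.mem_univ, true_and, Prod.mk.injEq]
  constructor
  · rintro ⟨i, rfl, rfl⟩
    rfl
  · rintro rfl
    exact ⟨j, rfl, rfl⟩

/-- The extension of an obstruction to uniformity one higher. -/
noncomputable def extend : SepObstruction (r + 1) k where
  Vertex := S.ExtVertex
  Color := Fin k × S.Color
  edges := {e | ∃ b i, (b i).1 ∈ S.edges ∧ e = S.extEdge b i}
  list := S.extList
  part := Sum.elim (fun x => (S.part x.2).castSucc) (fun _ => Fin.last r)
  ncard_eq := by
    rintro _ ⟨b, i, hb, rfl⟩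
    have hinj : Function.Injective fun v : S.Vertex => (Sum.inl (i, v) : S.ExtVertex) :=
      fun u v h => by simpa using h
    rw [extEdge, Set.ncard_insert_of_notMem (by simp) (Set.toFinite _),
      Set.ncard_image_of_injective _ hinj, S.ncard_eq _ hb]
  part_injOn := by
    rintro _ ⟨b, i, hb, rfl⟩ x hx y hy hxy
    rcases hx with rfl | ⟨u, hu, rfl⟩ <;> rcases hy with rfl | ⟨v, hv, rfl⟩
    · rfl
    · exact absurd hxy.symm (Fin.castSucc_lt_last _).ne
    · exact absurd hxy (Fin.castSucc_lt_last _).ne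
    · have := S.part_injOn _ hb hu hv (Fin.castSucc_injective r hxy)
      simp only [this]
  card_list := by
    classical
    rintro (⟨i, v⟩ | b)
    · have h : S.extList (Sum.inl (i, v)) = (S.list v).image (Prod.mk i) := by
        ext ⟨j, c⟩
        simp only [mem_extList_inl, Finset.mem_image, Prod.mk.injEq]
        grind
      rw [h, Finset.card_image_of_injective _ (Prod.mk_right_injective i), S.card_list]
    · have h : S.extList (Sum.inr b) = Finset.univ.image fun i => (i, (b i).2) := by
        ext ⟨j, c⟩
        simp only [mem_extList_inr, Finset.mem_image, Prod.mk.injEq, Finset.mem_univ, true_and]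
        grind
      rw [h, Finset.card_image_of_injective _ fun i j hij => (Prod.ext_iff.1 hij).1,
        Finset.card_univ, Fintype.card_fin]
  separated := by
    rintro _ ⟨b, i, hb, rfl⟩ x hx y hy hxy a hax hay c hcx hcy
    rcases hx with rfl | ⟨u, hu, rfl⟩ <;> rcases hy with rfl | ⟨v, hv, rfl⟩
    · exact absurd rfl hxy
    -- The list of a new vertex contains exactly one color from each palette.
    · rw [mem_extList_inr] at hax hcx
      rw [mem_extList_inl] at hay hcy
      have h1 := hay.1.trans hcy.1.symm
      exact Prod.ext h1 (by rw [hax, hcx, h1])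
    · rw [mem_extList_inl] at hax hcx
      rw [mem_extList_inr] at hay hcy
      have h1 := hax.1.trans hcx.1.symm
      exact Prod.ext h1 (by rw [hay, hcy, h1])
    · rw [mem_extList_inl] at hax hay hcx hcy
      refine Prod.ext (hax.1.trans hcx.1.symm)
        (S.separated _ hb u hu v hv ?_ _ hax.2 hay.2 _ hcx.2 hcy.2)
      rintro rfl
      exact hxy rfl
  exists_monochromatic := by
    intro φ hφ
    have hinl : ∀ i v, (φ (Sum.inl (i, v))).1 = i ∧ (φ (Sum.inl (i, v))).2 ∈ S.list v :=
      fun i v => S.mem_extList_inl.1 (hφ (Sum.inl (i, v)))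
    choose E hE a ha using fun i => S.exists_monochromatic (fun v => (φ (Sum.inl (i, v))).2)
      fun v => (hinl i v).2
    let b : Fin k → Set S.Vertex × S.Color := fun i => (E i, a i)
    have hb : (φ (Sum.inr b)).2 = a (φ (Sum.inr b)).1 := S.mem_extList_inr.1 (hφ (Sum.inr b))
    -- The palette of the color of `b` names the copy whose selected edge it completes.
    refine ⟨_, ⟨b, (φ (Sum.inr b)).1, hE _, rfl⟩, φ (Sum.inr b), ?_⟩
    rintro x (rfl | ⟨v, hv, rfl⟩)
    · rfl
    · exact Prod.ext (hinl _ v).1 ((ha _ v hv).trans hb.symm)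

/-- The hypergraph underlying an obstruction. -/
def toHypergraph : Hypergraph S.Vertex where
  vertexSet := Set.univ
  edgeSet := S.edges
  subset_vertexSet_of_mem_edgeSet' := fun _ _ => Set.subset_univ _

theorem isUniform_toHypergraph : S.toHypergraph.IsUniform r := S.ncard_eq

theorem isPartite_toHypergraph : S.toHypergraph.IsPartite r := by
  refine ⟨fun i => S.part ⁻¹' {i}, ?_, ?_, ?_⟩
  · intro i j hij
    rw [Set.disjoint_left]
    rintro v rfl hv
    exact hij hv
  · ext v
    simp [toHypergraph]
  · rintro e he i u ⟨hu, hui⟩ v ⟨hv, hvi⟩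
    exact S.part_injOn e he hu hv (hui.trans hvi.symm)

theorem not_isSepChoosable_toHypergraph : ¬ S.toHypergraph.IsSepChoosable k := by
  classical
  intro h
  obtain ⟨ι, hι⟩ : ∃ ι : S.Color → ℤ, Function.Injective ι := by
    obtain ⟨f, hf⟩ := Countable.exists_injective_nat S.Color
    exact ⟨fun c => (f c : ℤ), Nat.cast_injective.comp hf⟩
  obtain ⟨φ, hφ, hproper⟩ := h (fun v => (S.list v).image ι)
    (fun v _ => by rw [Finset.card_image_of_injective _ hι, S.card_list])
    (fun e he u hu v hv huv => by
      rw [← Finset.image_inter _ _ hι, Finset.card_image_of_injective _ hι, Finset.card_le_one]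
      intro a ha b hb
      rw [Finset.mem_inter] at ha hb
      exact S.separated e he u hu v hv huv a ha.1 ha.2 b hb.1 hb.2)
  have hex : ∀ v, ∃ a ∈ S.list v, ι a = φ v := fun v =>
    Finset.mem_image.1 (hφ v (Set.mem_univ v))
  choose ψ hψ hψφ using hex
  obtain ⟨e, he, a, ha⟩ := S.exists_monochromatic ψ hψ
  exact hproper e he ⟨ι a, fun v hv => by rw [← hψφ, ha v hv]⟩

/-- The new vertices serve as `B`: `b` lies only in the edges `S.extEdge b i`, one for each of the
`k` copies. -/
theorem isDPColorable_extend (hr : 0 < r) : S.extend.toHypergraph.IsDPColorable (k + 1) := by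
  refine isDPColorable_of_degree_le (Set.range Sum.inr : Set S.ExtVertex) ?_ ?_ ?_ ?_
  · intro e he
    have := S.extend.ncard_eq e he
    exact (Set.one_lt_ncard_iff_nontrivial_and_finite.1 (by omega)).1
  · rintro _ ⟨b, i, hb, rfl⟩
    refine ⟨Sum.inr b, ⟨b, rfl⟩, ?_⟩
    ext x
    constructor
    · rintro ⟨rfl | ⟨v, hv, rfl⟩, ⟨c, hc⟩⟩
      · rfl
      · cases hc
    · rintro rfl
      exact ⟨Or.inl rfl, b, rfl⟩
  · exact fun _ _ => Set.toFinite _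
  · rintro _ ⟨b, rfl⟩
    have hcard : (Set.range (S.extEdge b)).ncard ≤ k := by
      rw [← Set.image_univ]
      refine (Set.ncard_image_le (Set.toFinite _)).trans ?_
      rw [Set.ncard_univ, Nat.card_fin]
    have hsub : {e | e ∈ S.extend.toHypergraph.edgeSet ∧ Sum.inr b ∈ e} ⊆
        Set.range (S.extEdge b) := by
      rintro _ ⟨⟨c, i, hc, rfl⟩, hbc | ⟨v, _, hv⟩⟩
      · cases hbc
        exact ⟨i, rfl⟩
      · cases hv
    exact (Set.ncard_le_ncard hsub (Set.toFinite _)).trans hcard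

theorem nonempty (k n : ℕ) : Nonempty (SepObstruction (n + 1) k) := by
  induction n with
  | zero => exact ⟨single k⟩
  | succ n ih => exact ih.map extend

end SepObstruction

end Hypergraph

/-! ### Equality of the five invariants -/

theorem Nat.sInf_eq_of_mem_of_forall_lt {P : ℕ → Prop} {d : ℕ} (hd : P d)
    (h : ∀ j < d, ¬ P j) : sInf {k | P k} = d :=
  (Nat.sInf_le hd).antisymm (le_csInf ⟨d, hd⟩ fun j hj => not_lt.1 fun hlt => h j hlt hj)

open Hypergraph in
theorem mainTheorem6 (r d : ℕ) (hr : 2 ≤ r) (hd : 2 ≤ d) :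
    ∃ (V : Type) (H : Hypergraph V), H.vertexSet.Finite ∧ H.IsUniform r ∧ H.IsPartite r ∧
      H.chSep = d ∧ H.chAd = d ∧ H.singleConflictChromaticNumber = d ∧ H.ch = d ∧
      H.dpChromaticNumber = d := by
  obtain ⟨n, rfl⟩ := Nat.exists_eq_add_of_le' hr
  obtain ⟨k, rfl⟩ : ∃ k, d = k + 1 := ⟨d - 1, by omega⟩
  -- Uniformity `n + 1 = r - 1`: the last extension is kept explicit because the DP bound uses its
  -- new vertices.
  obtain ⟨S⟩ := SepObstruction.nonempty k n
  have hnt : ∀ e ∈ S.extend.toHypergraph.edgeSet, e.Nontrivial := fun e he => by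
    have := S.extend.ncard_eq e he
    exact (Set.one_lt_ncard_iff_nontrivial_and_finite.1 (by omega)).1
  have hdp := S.isDPColorable_extend n.succ_pos
  have hconf := hdp.isConflictColorable k.succ_pos
  have had := hconf.isAdChoosable k.succ_pos
  have hch := hdp.isChoosable
  have hlt : ∀ j < k + 1, ¬ S.extend.toHypergraph.IsSepChoosable j := fun j hj h =>
    S.extend.not_isSepChoosable_toHypergraph (h.mono (Nat.lt_succ_iff.1 hj))
  refine ⟨_, S.extend.toHypergraph, Set.toFinite _, S.extend.isUniform_toHypergraph,
    S.extend.isPartite_toHypergraph, ?_, ?_, ?_, ?_, ?_⟩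
  · exact Nat.sInf_eq_of_mem_of_forall_lt hch.isSepChoosable hlt
  · exact Nat.sInf_eq_of_mem_of_forall_lt had fun j hj h => hlt j hj (h.isSepChoosable hnt)
  · exact Nat.sInf_eq_of_mem_of_forall_lt ⟨k.succ_pos, hconf⟩ fun j hj h =>
      hlt j hj ((h.2.isAdChoosable h.1).isSepChoosable hnt)
  · exact Nat.sInf_eq_of_mem_of_forall_lt hch fun j hj h => hlt j hj h.isSepChoosable
  · exact Nat.sInf_eq_of_mem_of_forall_lt hdp fun j hj h => hlt j hj h.isChoosable.isSepChoosable
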